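/- Let $n\ge 1$. All processes are $\mathbb R^n$-valued, indexed by $t\in\mathbb R$, and defined on a probability space; $\stackrel{\mathcal L}{=}$ denotes equality of finite-dimensional distributions. For a real $n\times n$ matrix $H$ and $c>0$ put $c^H=\exp((\log c)H)$. A process $X$ is *proper* if, for every $t\neq 0$, the law of $X(t)$ is not contained in a proper linear subspace of $\mathbb R^n$. A real matrix $H$ is an *exponent* of $X$ if $\{X(ct)\}_{t\in\mathbb R}\stackrel{\mathcal L}{=}\{c^HX(t)\}_{t\in\mathbb R}$ for every $c>0$. The process $X$ is *operator self-similar* if it is proper, is continuous in law at every $t\in\mathbb R$, and has an exponent. It has *stationary increments* if the law of $\{X(t+h)-X(h)\}_{t\in\mathbb R}$ does not depend on $h\in\mathbb R$. It is *time-reversible* if $\{X(t)\}_{t\in\mathbb R}\stackrel{\mathcal L}{=}\{X(-t)\}_{t\in\mathbb R}$. An *operator fractional Brownian motion* (OFBM) is a Gaussian operator self-similar process with stationary increments. An *operator Brownian motion* (OBM) is a zero-mean Gaussian operator self-similar process $X$ with stationary and independent increments such that $X(0)=0$ almost surely. **Corollary.** If $X$ is a time-reversible OFBM that has $\tfrac12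 I$ as an exponent, then $X$ is an OBM. Conversely, if $X$ is an OBM, then $X$ is time-reversible and has $\tfrac12 I$ as an exponent. -/

import Mathlib

open MeasureTheory ProbabilityTheory Filter Topology

noncomputable section

namespace OperatorFBM

/-- The state space `ℝⁿ`. -/
abbrev State (n : ℕ) : Type := EuclideanSpace ℝ (Fin n)

variable {n : ℕ} {Ω : Type*} [MeasurableSpace Ω]

/-- Equality of the finite-dimensional distributions of two `ℝⁿ`-valued processes indexed
by `ℝ`. -/
def SameFiniteDimLaws (X Y : ℝ → Ω → State n) (P : Measure Ω) : Prop :=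
  ∀ I : Finset ℝ, IdentDistrib (fun ω ↦ I.restrict (X · ω)) (fun ω ↦ I.restrict (Y · ω)) P P

/-- The matrix power `c ^ H = exp (log c • H)`, used for `c > 0`. -/
def scalarPow (c : ℝ) (H : Matrix (Fin n) (Fin n) ℝ) : Matrix (Fin n) (Fin n) ℝ :=
  NormedSpace.exp (Real.log c • H)

/-- `H` is a self-similarity exponent of `X`: for every `c > 0` the processes
`{X (c t)}` and `{c ^ H X t}` have the same finite-dimensional distributions. -/
def IsExponent (X : ℝ → Ω → State n) (P : Measure Ω) (H : Matrix (Fin n) (Fin n) ℝ) : Prop :=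
  ∀ c : ℝ, 0 < c → SameFiniteDimLaws (fun t ω ↦ X (c * t) ω)
    (fun t ω ↦ Matrix.toEuclideanCLM (𝕜 := ℝ) (scalarPow c H) (X t ω)) P

/-- `X` is proper: for `t ≠ 0` the law of `X t` is not contained in a proper linear subspace.
(The time `0` is excluded, since the processes of interest vanish there.) -/
def IsProper (X : ℝ → Ω → State n) (P : Measure Ω) : Prop :=
  ∀ t : ℝ, t ≠ 0 → ∀ V : Submodule ℝ (State n), V ≠ ⊤ → ¬ ∀ᵐ ω ∂P, X t ω ∈ V

/-- `X` is continuous in law at every time. -/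
def IsContinuousInLaw (X : ℝ → Ω → State n) (P : Measure Ω) [IsProbabilityMeasure P] : Prop :=
  ∀ t : ℝ, TendstoInDistribution X (𝓝 t) (X t) (fun _ ↦ P) P

/-- `X` is operator self-similar. -/
structure IsOSS (X : ℝ → Ω → State n) (P : Measure Ω) [IsProbabilityMeasure P] : Prop where
  proper : IsProper X P
  continuousInLaw : IsContinuousInLaw X P
  exists_exponent : ∃ H : Matrix (Fin n) (Fin n) ℝ, IsExponent X P H

/-- `X` has stationary increments: the law of `{X (t + h) - X h}` does not depend on `h`. -/
def HasStationaryIncrements (X : ℝ → Ω → State n) (P : Measure Ω) : Prop :=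
  ∀ h : ℝ, SameFiniteDimLaws (fun t ω ↦ X (t + h) ω - X h ω) (fun t ω ↦ X t ω - X 0 ω) P

/-- `X` is time-reversible: `{X t}` and `{X (-t)}` have the same finite-dimensional
distributions. -/
def IsTimeReversible (X : ℝ → Ω → State n) (P : Measure Ω) : Prop :=
  SameFiniteDimLaws X (fun t ω ↦ X (-t) ω) P

/-- Operator fractional Brownian motion: a Gaussian operator self-similar process with
stationary increments. -/
structure IsOFBM (X : ℝ → Ω → State n) (P : Measure Ω) [IsProbabilityMeasure P] : Prop where
  gaussian : IsGaussianProcess X P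
  oss : IsOSS X P
  stationaryIncrements : HasStationaryIncrements X P

/-- Operator Brownian motion: a zero-mean Gaussian operator self-similar process with
stationary and independent increments that vanishes almost surely at time `0`.
(Without zero mean, the deterministic process `X t = t` on `ℝ` would qualify, with exponent `1`.) -/
structure IsOBM (X : ℝ → Ω → State n) (P : Measure Ω) [IsProbabilityMeasure P] : Prop where
  gaussian : IsGaussianProcess X P
  zeroMean : ∀ t : ℝ, ∫ ω, X t ω ∂P = 0
  oss : IsOSS X P
  stationaryIncrements : HasStationaryIncrements X P
  indepIncrements : HasIndepIncrements X P
  zero : ∀ᵐ ω ∂P, X 0 ω = 0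

end OperatorFBM

end

namespace OperatorFBM

/-! A Gaussian process is determined by its means and the kernels R(s,t) = cov(L X_s, M X_t), with
`L`, `M` dual vectors, so both directions concern these kernels. R need not be symmetric when `L` ≠
`M`.

Forward: exponent 1/2 makes R homogeneous of degree one and kills X_0 and the mean. Stationarity and
reversibility force A(s,t) = R(s,t) - R(t,s) to be biadditive, so doubling both times multiplies A
by 4, while homogeneity says 2; hence A = 0 (`kernel_symm`). Then 2R(s,t) = (|s| + |t| - |t - s|)
R(1,1), so disjoint increments are uncorrelated, hence independent.

Converse: uncorrelated increments reduce R to its diagonal (`kernel_eq_of_uncorrelated`), which is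
even, and additive on [0, ∞). For `L` = `M` it is also nonnegative, hence linear; polarization
covers `L` ≠ `M` (`crossCov_diag_mul`). -/

/-- A nonnegative additive function on `[0, ∞)` is linear. -/
theorem eq_mul_of_nonneg_of_add {g : ℝ → ℝ} (hg : ∀ t, 0 ≤ t → 0 ≤ g t)
    (hadd : ∀ s t, 0 ≤ s → 0 ≤ t → g (s + t) = g s + g t) {c t : ℝ} (hc : 0 ≤ c) (ht : 0 ≤ t) :
    g (c * t) = c * g t := by
  have hmono : ∀ s u, 0 ≤ s → s ≤ u → g s ≤ g u := fun s u hs hsu ↦ by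
    have h1 := hadd s (u - s) hs (by linarith)
    have h2 := hg (u - s) (by linarith)
    rw [add_sub_cancel] at h1
    linarith
  have hzero : g 0 = 0 := by
    have := hadd 0 0 le_rfl le_rfl
    rw [add_zero] at this
    linarith
  have hnat : ∀ (k : ℕ) (s : ℝ), 0 ≤ s → g (k * s) = k * g s := fun k s hs ↦ by
    induction k with
    | zero => simp [hzero]
    | succ k ih =>
      push_cast
      rw [add_one_mul, hadd _ _ (by positivity) hs, ih]
      ring
  -- With k = ⌊Nc⌋, both N g(ct) and Nc g(t) lie between k g(t) and (k + 1) g(t).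
  have hbound : ∀ N : ℕ, N * |g (c * t) - c * g t| ≤ g t := fun N ↦ by
    have hk := Nat.floor_le (show 0 ≤ N * c by positivity)
    have hk' := (Nat.lt_floor_add_one (N * c)).le
    set k := ⌊N * c⌋₊
    have h1 := hmono (k * t) (N * (c * t)) (by positivity) (by nlinarith)
    have h2 := hmono (N * (c * t)) ((k + 1 : ℕ) * t) (by positivity) (by push_cast; nlinarith)
    rw [hnat _ _ ht, hnat _ _ (by positivity)] at h1
    rw [hnat _ _ ht, hnat _ _ (by positivity)] at h2
    push_cast at h2
    have h3 := hg t ht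
    have h4 : k * g t ≤ N * c * g t := by gcongr
    have h5 : N * c * g t ≤ (k + 1) * g t := by gcongr
    rw [← abs_of_nonneg (show (0 : ℝ) ≤ N by positivity), ← abs_mul, abs_le]
    constructor <;> nlinarith
  by_contra hne
  obtain ⟨N, hN⟩ := exists_nat_gt (g t / |g (c * t) - c * g t|)
  rw [div_lt_iff₀ (abs_pos.2 (sub_ne_zero.2 hne))] at hN
  linarith [hbound N]

/-! ### Reversible homogeneous kernels -/

/-- A kernel vanishing on the axes, invariant under time reversal, homogeneous of degree one, and
compatible with translation of increments, is symmetric. -/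
theorem kernel_symm {R : ℝ → ℝ → ℝ} (hl : ∀ t, R 0 t = 0) (hr : ∀ t, R t 0 = 0)
    (heven : ∀ s t, R (-s) (-t) = R s t) (hscale : ∀ s t, R (2 * s) (2 * t) = 2 * R s t)
    (htrans : ∀ s t h, R (s + h) (t + h) - R (s + h) h - R h (t + h) + R h h = R s t) (s t : ℝ) :
    R s t = R t s := by
  obtain ⟨A, hA⟩ : ∃ A : ℝ → ℝ → ℝ, ∀ s t, A s t = R s t - R t s := ⟨_, fun _ _ ↦ rfl⟩
  have hskew : ∀ x y, A x y = -A y x := fun x y ↦ by rw [hA, hA]; ring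
  have hT : ∀ x y h, A (x + h) (y + h) - A (x + h) h - A h (y + h) = A x y := fun x y h ↦ by
    simp only [hA]
    linarith [htrans x y h, htrans y x h]
  -- Translate by -y, then reverse time to turn (x - y, -y) into (y - x, y).
  have hreflect : ∀ x y, A (y - x) y = -A x y := fun x y ↦ by
    have h1 := hT x y (-y)
    have h2 : A (x + -y) (-y) = A (y - x) y := by
      simp only [hA]
      rw [← heven (y - x), ← heven y (y - x)]
      simp [sub_eq_add_neg]
    have h3 : ∀ z, A z 0 = 0 := fun z ↦ by simp [hA, hl, hr]
    rw [add_neg_cancel, h2, h3, h3] at h1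
    linarith
  have hcomm : ∀ x y, A (x + y) y - A (x + y) x = 2 * A x y := fun x y ↦ by
    have h1 := hT (x - y) x y
    rw [sub_add_cancel] at h1
    linarith [hreflect y x, hskew (x + y) x, hskew (x + y) y, hskew x y]
  -- In `h3` - `h1` - `h2` the terms A(x + y + z, ·) reduce to the left side of `h4`; `h5` and `h6`
  -- absorb the rest.
  have hadd : ∀ x y z, A (x + y) z = A x z + A y z := fun x y z ↦ by
    have h1 := hT (x + y) y z
    have h2 := hT (z + x) x y
    have h3 := hT (x + z) z y
    have e1 : x + y + z = z + (x + y) := by ring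
    have e2 : z + x + y = z + (x + y) := by ring
    have e3 : x + z + y = z + (x + y) := by ring
    have h4 := hcomm (x + y) z
    have h5 := hcomm x z
    have h6 := hcomm y z
    rw [e1] at h1 h4
    rw [e2] at h2
    rw [e3, add_comm z y] at h3
    rw [add_comm z x] at h2
    linarith [hskew z (y + z), hskew y (x + y), hskew y (y + z)]
  have h1 : A (2 * s) (2 * t) = 2 * A s t := by
    simp only [hA, hscale]
    ring
  have h2 : A (2 * s) (2 * t) = 4 * A s t := by
    rw [two_mul s, hadd, hskew, two_mul, hadd, hskew t]
    ring
  linarith [hA s t]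

/-- For ordered times |t - s| = t - s, so 2R(s,t) is a function of s plus a function of t, and its
mixed difference vanishes. -/
theorem kernel_increments_eq_zero {R : ℝ → ℝ → ℝ} (hl : ∀ t, R 0 t = 0) (hr : ∀ t, R t 0 = 0)
    (heven : ∀ s t, R (-s) (-t) = R s t)
    (hscale : ∀ c s t, 0 < c → R (c * s) (c * t) = c * R s t)
    (htrans : ∀ s t h, R (s + h) (t + h) - R (s + h) h - R h (t + h) + R h h = R s t)
    {a b c d : ℝ} (hab : a ≤ b) (hbc : b ≤ c) (hcd : c ≤ d) :
    R b d - R b c - R a d + R a c = 0 := by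
  have hdiag : ∀ x, R x x = |x| * R 1 1 := fun x ↦ by
    rcases lt_trichotomy x 0 with h | rfl | h
    · rw [← heven, abs_of_neg h, ← hscale _ _ _ (neg_pos.2 h), mul_one]
    · simp [hl]
    · rw [abs_of_pos h, ← hscale _ _ _ h, mul_one]
  have hsymm := kernel_symm hl hr heven (fun s t ↦ hscale 2 s t two_pos) htrans
  have key : ∀ s t, s ≤ t → 2 * R s t = (|s| + |t| - (t - s)) * R 1 1 := fun s t hst ↦ by
    have h := htrans (t - s) (t - s) s
    rw [sub_add_cancel, hdiag t, hdiag s, hdiag (t - s), hsymm t s,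
      abs_of_nonneg (sub_nonneg.2 hst)] at h
    linarith
  linarith [key b d (by linarith), key b c hbc, key a d (by linarith), key a c (by linarith)]

/-! ### Kernels with uncorrelated increments -/

section UncorrelatedKernel

variable {R : ℝ → ℝ → ℝ}

/-- Taking time 0 as an endpoint of one of two adjacent intervals leaves only the diagonal value at
the point nearer 0, or nothing when 0 separates s and t. -/
theorem kernel_eq_of_uncorrelated (hl : ∀ t, R 0 t = 0) (hr : ∀ t, R t 0 = 0)
    (hindep : ∀ a b c d, a ≤ b → b ≤ c → c ≤ d → R b d - R b c - R a d + R a c = 0)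
    {s t : ℝ} (hst : s ≤ t) :
    R s t = if 0 ≤ s then R s s else if t ≤ 0 then R t t else 0 := by
  split_ifs with h1 h2
  · linarith [hindep 0 s s t h1 le_rfl hst, hl t, hl s]
  · linarith [hindep s t t 0 hst le_rfl h2, hr t, hr s]
  · linarith [hindep s 0 0 t (by linarith) le_rfl (by linarith), hl t, hr s, hr 0]

theorem kernel_diag_add (hl : ∀ t, R 0 t = 0) (hr : ∀ t, R t 0 = 0)
    (hindep : ∀ a b c d, a ≤ b → b ≤ c → c ≤ d → R b d - R b c - R a d + R a c = 0)
    (hindep' : ∀ a b c d, a ≤ b → b ≤ c → c ≤ d → R d b - R c b - R d a + R c a = 0)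
    (htrans : ∀ s t h, R (s + h) (t + h) - R (s + h) h - R h (t + h) + R h h = R s t)
    {s t : ℝ} (hs : 0 ≤ s) (ht : 0 ≤ t) : R (s + t) (s + t) = R s s + R t t := by
  have h1 := htrans t t s
  rw [add_comm t s] at h1
  linarith [hindep 0 s s (s + t) hs le_rfl (by linarith), hl s, hl (s + t),
    hindep' 0 s s (s + t) hs le_rfl (by linarith), hr s, hr (s + t)]

theorem kernel_diag_neg (hl : ∀ t, R 0 t = 0) (hr : ∀ t, R t 0 = 0)
    (htrans : ∀ s t h, R (s + h) (t + h) - R (s + h) h - R h (t + h) + R h h = R s t)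
    (t : ℝ) : R (-t) (-t) = R t t := by
  have h := htrans t t (-t)
  rw [add_neg_cancel] at h
  linarith [hl 0, hl (-t), hr (-t)]

/-- Negation reverses the order of the times, so one side is evaluated through R and the other
through its transpose, governed by `hindep'`. -/
theorem kernel_neg (hl : ∀ t, R 0 t = 0) (hr : ∀ t, R t 0 = 0)
    (hindep : ∀ a b c d, a ≤ b → b ≤ c → c ≤ d → R b d - R b c - R a d + R a c = 0)
    (hindep' : ∀ a b c d, a ≤ b → b ≤ c → c ≤ d → R d b - R c b - R d a + R c a = 0)
    (htrans : ∀ s t h, R (s + h) (t + h) - R (s + h) h - R h (t + h) + R h h = R s t)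
    (s t : ℝ) : R (-s) (-t) = R s t := by
  have hneg := kernel_diag_neg hl hr htrans
  rcases le_total s t with h | h
  · rw [kernel_eq_of_uncorrelated hl hr hindep h,
      kernel_eq_of_uncorrelated (R := fun x y ↦ R y x) hr hl hindep' (neg_le_neg h)]
    have := hl 0
    split_ifs <;> grind
  · rw [kernel_eq_of_uncorrelated hl hr hindep (neg_le_neg h),
      kernel_eq_of_uncorrelated (R := fun x y ↦ R y x) hr hl hindep' h]
    have := hl 0
    split_ifs <;> grind

theorem kernel_mul (hl : ∀ t, R 0 t = 0) (hr : ∀ t, R t 0 = 0)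
    (hindep : ∀ a b c d, a ≤ b → b ≤ c → c ≤ d → R b d - R b c - R a d + R a c = 0)
    (hindep' : ∀ a b c d, a ≤ b → b ≤ c → c ≤ d → R d b - R c b - R d a + R c a = 0)
    {c : ℝ} (hc : 0 < c) (hdiag : ∀ t, R (c * t) (c * t) = c * R t t) (s t : ℝ) :
    R (c * s) (c * t) = c * R s t := by
  have hpos : ∀ x, 0 ≤ c * x ↔ 0 ≤ x := fun x ↦ mul_nonneg_iff_of_pos_left hc
  have hneg : ∀ x, c * x ≤ 0 ↔ x ≤ 0 := fun x ↦ by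
    rw [← not_lt, ← not_lt, mul_pos_iff_of_pos_left hc]
  rcases le_total s t with h | h
  · rw [kernel_eq_of_uncorrelated hl hr hindep h,
      kernel_eq_of_uncorrelated hl hr hindep (mul_le_mul_of_nonneg_left h hc.le)]
    simp only [hpos, hneg, hdiag, mul_ite, mul_zero]
  · rw [kernel_eq_of_uncorrelated (R := fun x y ↦ R y x) hr hl hindep' h,
      kernel_eq_of_uncorrelated (R := fun x y ↦ R y x) hr hl hindep'
        (mul_le_mul_of_nonneg_left h hc.le)]
    simp only [hpos, hneg, hdiag, mul_ite, mul_zero]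

end UncorrelatedKernel

/-! ### Cross-covariances of Gaussian processes -/

section CrossCovariance

variable {Ω E F T : Type*} [MeasurableSpace Ω] {P : Measure Ω}
  [NormedAddCommGroup E] [NormedSpace ℝ E]

/-- The covariance between the scalar marginals `L (X s)` and `M (X t)`. -/
noncomputable def crossCov (X : T → Ω → E) (P : Measure Ω) (L M : StrongDual ℝ E) (s t : T) : ℝ :=
  cov[fun ω ↦ L (X s ω), fun ω ↦ M (X t ω); P]

theorem crossCov_comm (X : T → Ω → E) (L M : StrongDual ℝ E) (s t : T) :
    crossCov X P L M s t = crossCov X P M L t s :=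
  covariance_comm _ _

theorem identDistrib_covariance_eq [MeasurableSpace F] {f g : Ω → F} (h : IdentDistrib f g P P)
    {φ ψ : F → ℝ} (hφ : Measurable φ) (hψ : Measurable ψ) :
    cov[fun ω ↦ φ (f ω), fun ω ↦ ψ (f ω); P] = cov[fun ω ↦ φ (g ω), fun ω ↦ ψ (g ω); P] := by
  rw [← covariance_map_fun hφ.aestronglyMeasurable hψ.aestronglyMeasurable h.aemeasurable_fst,
    ← covariance_map_fun hφ.aestronglyMeasurable hψ.aestronglyMeasurable h.aemeasurable_snd,
    h.map_eq]

theorem crossCov_eq_zero_of_ae_eq_zero_right {X : T → Ω → E} {t : T} (h : ∀ᵐ ω ∂P, X t ω = 0)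
    (L M : StrongDual ℝ E) (s : T) : crossCov X P L M s t = 0 := by
  have h0 : (fun ω ↦ M (X t ω)) =ᵐ[P] 0 := by
    filter_upwards [h] with ω hω
    simp [hω]
  refine integral_eq_zero_of_ae ?_
  filter_upwards [h0] with ω hω
  simp [integral_congr_ae h0, hω]

theorem crossCov_eq_zero_of_ae_eq_zero_left {X : T → Ω → E} {s : T} (h : ∀ᵐ ω ∂P, X s ω = 0)
    (L M : StrongDual ℝ E) (t : T) : crossCov X P L M s t = 0 := by
  rw [crossCov_comm, crossCov_eq_zero_of_ae_eq_zero_right h]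

variable [MeasurableSpace E] [BorelSpace E]

theorem memLp_two_dual {X : T → Ω → E} (hX : IsGaussianProcess X P) (L : StrongDual ℝ E) (t : T) :
    MemLp (fun ω ↦ L (X t ω)) 2 P :=
  ((hX.hasGaussianLaw_eval t).map_fun L).memLp_two

theorem covariance_increments {X : T → Ω → E} (hX : IsGaussianProcess X P)
    (L M : StrongDual ℝ E) (a b c d : T) :
    cov[fun ω ↦ L (X b ω - X a ω), fun ω ↦ M (X d ω - X c ω); P] =
      crossCov X P L M b d - crossCov X P L M b c - crossCov X P L M a d +
        crossCov X P L M a c := by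
  have := hX.isProbabilityMeasure
  simp only [map_sub]
  exact covariance_fun_sub_fun_sub (memLp_two_dual hX L b) (memLp_two_dual hX L a)
    (memLp_two_dual hX M d) (memLp_two_dual hX M c)

theorem crossCov_add_self {X : T → Ω → E} (hX : IsGaussianProcess X P)
    (L M : StrongDual ℝ E) (t : T) :
    crossCov X P (L + M) (L + M) t t =
      crossCov X P L L t t + 2 * crossCov X P L M t t + crossCov X P M M t t := by
  have := hX.isProbabilityMeasure
  have hL := memLp_two_dual hX L t
  have hM := memLp_two_dual hX M t
  have h : crossCov X P (L + M) (L + M) t t =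
      cov[(fun ω ↦ L (X t ω)) + fun ω ↦ M (X t ω), (fun ω ↦ L (X t ω)) + fun ω ↦ M (X t ω); P] :=
    rfl
  rw [h, covariance_add_left hL hM (hL.add hM), covariance_add_right hL hL hM,
    covariance_add_right hM hL hM, covariance_comm (fun ω ↦ M (X t ω)) (fun ω ↦ L (X t ω))]
  simp only [crossCov]
  ring

variable [SecondCountableTopology E] [CompleteSpace E]

/-- Gaussian processes with the same means and cross-covariances have the same
finite-dimensional distributions. -/
theorem identDistrib_restrict_of_crossCov_eq {X Y : T → Ω → E}
    (hX : IsGaussianProcess X P) (hY : IsGaussianProcess Y P)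
    (hmean : ∀ t, ∫ ω, X t ω ∂P = ∫ ω, Y t ω ∂P)
    (hcov : ∀ L M s t, crossCov X P L M s t = crossCov Y P L M s t) (I : Finset T) :
    IdentDistrib (fun ω ↦ I.restrict (X · ω)) (fun ω ↦ I.restrict (Y · ω)) P P := by
  classical
  have := hX.isProbabilityMeasure
  have hXI := hX.hasGaussianLaw I
  have hYI := hY.hasGaussianLaw I
  refine ⟨hXI.aemeasurable, hYI.aemeasurable, ?_⟩
  have := hXI.isGaussian_map
  have := hYI.isGaussian_map
  refine Measure.ext_of_charFunDual (funext fun L ↦ ?_)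
  -- A functional on the product splits over coordinates, so its mean and variance involve only
  -- single means and cross-covariances.
  have hsum : ∀ Z : T → Ω → E, (fun ω ↦ L (I.restrict (Z · ω))) =
      fun ω ↦ ∑ i : I, (L ∘L .single ℝ (fun _ ↦ E) i) (Z i ω) := fun Z ↦ by
    ext ω
    rw [← L.sum_comp_single]
    rfl
  rw [hXI.charFunDual_map_eq_fun, hYI.charFunDual_map_eq_fun]
  have hm : ∫ ω, L (I.restrict (X · ω)) ∂P = ∫ ω, L (I.restrict (Y · ω)) ∂P := by
    rw [hsum, hsum,
      integral_finsetSum _ fun (i : I) _ ↦ ((hX.hasGaussianLaw_eval i.1).map_fun _).integrable,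
      integral_finsetSum _ fun (i : I) _ ↦ ((hY.hasGaussianLaw_eval i.1).map_fun _).integrable]
    refine Finset.sum_congr rfl fun i _ ↦ ?_
    rw [ContinuousLinearMap.integral_comp_comm _ (hX.hasGaussianLaw_eval i).integrable,
      ContinuousLinearMap.integral_comp_comm _ (hY.hasGaussianLaw_eval i).integrable, hmean]
  have hv : Var[fun ω ↦ L (I.restrict (X · ω)); P] = Var[fun ω ↦ L (I.restrict (Y · ω)); P] := by
    rw [hsum, hsum, variance_fun_sum fun (i : I) ↦ memLp_two_dual hX _ i.1,
      variance_fun_sum fun (i : I) ↦ memLp_two_dual hY _ i.1]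
    exact Finset.sum_congr rfl fun i _ ↦ Finset.sum_congr rfl fun j _ ↦ hcov _ _ _ _
  rw [hm, hv]

end CrossCovariance

/-! ### From finite-dimensional laws to kernels and back -/

section FiniteDimLaws

variable {n : ℕ} {Ω : Type*} [MeasurableSpace Ω] {P : Measure Ω} {X Y : ℝ → Ω → State n}

theorem SameFiniteDimLaws.identDistrib (h : SameFiniteDimLaws X Y P) (t : ℝ) :
    IdentDistrib (X t) (Y t) P P :=
  (h {t}).comp (measurable_pi_apply (⟨t, by simp⟩ : ({t} : Finset ℝ)))

theorem SameFiniteDimLaws.crossCov_eq (h : SameFiniteDimLaws X Y P)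
    (L M : StrongDual ℝ (State n)) (s t : ℝ) :
    crossCov X P L M s t = crossCov Y P L M s t :=
  identDistrib_covariance_eq (h {s, t}) (φ := fun x ↦ L (x ⟨s, by simp⟩))
    (ψ := fun x ↦ M (x ⟨t, by simp⟩)) (L.measurable.comp (measurable_pi_apply _))
    (M.measurable.comp (measurable_pi_apply _))

theorem scalarPow_half_smul_one {c : ℝ} (hc : 0 < c) :
    scalarPow c ((1 / 2 : ℝ) • (1 : Matrix (Fin n) (Fin n) ℝ)) = √c • 1 := by
  rw [scalarPow, smul_smul, Matrix.smul_one_eq_diagonal, Matrix.exp_diagonal,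
    Matrix.smul_one_eq_diagonal]
  congr 1
  ext i
  rw [Pi.coe_exp, ← Real.exp_eq_exp_ℝ, Real.sqrt_eq_rpow, Real.rpow_def_of_pos hc]

theorem isExponent_half_iff :
    IsExponent X P ((1 / 2 : ℝ) • (1 : Matrix (Fin n) (Fin n) ℝ)) ↔
      ∀ c : ℝ, 0 < c → SameFiniteDimLaws (fun t ω ↦ X (c * t) ω) (fun t ω ↦ √c • X t ω) P := by
  refine forall₂_congr fun c hc ↦ ?_
  rw [scalarPow_half_smul_one hc]
  simp

theorem crossCov_smul (X : ℝ → Ω → State n) (L M : StrongDual ℝ (State n)) (c s t : ℝ) :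
    crossCov (fun t ω ↦ c • X t ω) P L M s t = c ^ 2 * crossCov X P L M s t := by
  simp only [crossCov, map_smul, smul_eq_mul, covariance_const_mul_left,
    covariance_const_mul_right]
  ring

theorem crossCov_translate (hX : IsGaussianProcess X P) (hst : HasStationaryIncrements X P)
    (hzero : ∀ᵐ ω ∂P, X 0 ω = 0) (L M : StrongDual ℝ (State n)) (s t h : ℝ) :
    crossCov X P L M (s + h) (t + h) - crossCov X P L M (s + h) h - crossCov X P L M h (t + h) +
      crossCov X P L M h h = crossCov X P L M s t := by
  rw [← covariance_increments hX]
  refine ((hst h).crossCov_eq L M s t).trans ?_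
  refine (covariance_increments hX L M 0 s 0 t).trans ?_
  simp [crossCov_eq_zero_of_ae_eq_zero_right hzero, crossCov_eq_zero_of_ae_eq_zero_left hzero]

theorem hasIndepIncrements_of_crossCov (hX : IsGaussianProcess X P)
    (h : ∀ (L M : StrongDual ℝ (State n)) (a b c d : ℝ), a ≤ b → b ≤ c → c ≤ d →
      crossCov X P L M b d - crossCov X P L M b c - crossCov X P L M a d +
        crossCov X P L M a c = 0) :
    HasIndepIncrements X P := by
  intro m t ht
  refine hX.hasGaussianLaw_increments.iIndepFun_of_covariance_strongDual fun i j hij L M ↦ ?_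
  have key : ∀ {i j : Fin m}, i < j → ∀ L M : StrongDual ℝ (State n),
      cov[fun ω ↦ L (X (t i.succ) ω - X (t i.castSucc) ω),
        fun ω ↦ M (X (t j.succ) ω - X (t j.castSucc) ω); P] = 0 := fun {i j} hij L M ↦ by
    rw [covariance_increments hX]
    exact h L M _ _ _ _ (ht i.castSucc_le_succ) (ht (Fin.succ_le_castSucc_iff.2 hij))
      (ht j.castSucc_le_succ)
  rcases hij.lt_or_gt with hij | hij
  · exact key hij L M
  · rw [covariance_comm]
    exact key hij M L

theorem HasIndepIncrements.crossCov_eq_zero (hX : IsGaussianProcess X P)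
    (h : HasIndepIncrements X P) (L M : StrongDual ℝ (State n)) (a b c d : ℝ)
    (hab : a ≤ b) (hbc : b ≤ c) (hcd : c ≤ d) :
    crossCov X P L M b d - crossCov X P L M b c - crossCov X P L M a d +
      crossCov X P L M a c = 0 := by
  rw [← covariance_increments hX]
  let τ : Fin 4 → ℝ := ![a, b, c, d]
  have hτ : Monotone τ := by
    rw [Fin.monotone_iff_le_succ]
    intro i
    fin_cases i
    exacts [hab, hbc, hcd]
  -- Increments 0 and 2 of `τ` are those over [a, b] and [c, d].
  have hind := (h 3 τ hτ).indepFun (show (0 : Fin 3) ≠ 2 by decide)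
  refine (hind.comp L.measurable M.measurable).covariance_eq_zero ?_ ?_
  · exact ((hX.hasGaussianLaw_sub (s := b) (t := a)).map L).memLp_two
  · exact ((hX.hasGaussianLaw_sub (s := d) (t := c)).map M).memLp_two

/-- At c = 4, X_0 and 2 X_0 have the same law, so E‖X_0‖ = 2 E‖X_0‖. -/
theorem ae_zero_of_exponent_half (hX : IsGaussianProcess X P)
    (h : ∀ c : ℝ, 0 < c → SameFiniteDimLaws (fun t ω ↦ X (c * t) ω) (fun t ω ↦ √c • X t ω) P) :
    ∀ᵐ ω ∂P, X 0 ω = 0 := by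
  have h4 : IdentDistrib (X 0) (fun ω ↦ (2 : ℝ) • X 0 ω) P P := by
    have := (h 4 (by norm_num)).identDistrib 0
    rwa [mul_zero, show (4 : ℝ) = 2 ^ 2 by norm_num, Real.sqrt_sq zero_le_two] at this
  have hint := h4.norm.integral_eq
  simp only [norm_smul, Real.norm_ofNat, integral_const_mul] at hint
  have hnorm : ∫ ω, ‖X 0 ω‖ ∂P = 0 := by linarith
  rw [integral_eq_zero_iff_of_nonneg (fun ω ↦ norm_nonneg _)
    (hX.hasGaussianLaw_eval 0).integrable.norm] at hnorm
  filter_upwards [hnorm] with ω hω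
  simpa using hω

/-- Stationarity doubles the mean when time doubles, so the mean at 4t is four times that at t; the
exponent gives only twice. -/
theorem integral_eq_zero_of_exponent_half (hX : IsGaussianProcess X P)
    (hst : HasStationaryIncrements X P)
    (h : ∀ c : ℝ, 0 < c → SameFiniteDimLaws (fun t ω ↦ X (c * t) ω) (fun t ω ↦ √c • X t ω) P)
    (t : ℝ) : ∫ ω, X t ω ∂P = 0 := by
  have hint : ∀ s, Integrable (X s) P := fun s ↦ (hX.hasGaussianLaw_eval s).integrable
  have hzero := integral_congr_ae (ae_zero_of_exponent_half hX h)
  simp only [integral_zero] at hzero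
  have hdouble : ∀ s, ∫ ω, X (2 * s) ω ∂P = (2 : ℝ) • ∫ ω, X s ω ∂P := fun s ↦ by
    have := ((hst s).identDistrib s).integral_eq
    rw [integral_sub (hint _) (hint _), integral_sub (hint _) (hint _), hzero, sub_zero,
      sub_eq_iff_eq_add] at this
    rw [two_mul, two_smul, this]
  have h4 : ∫ ω, X (4 * t) ω ∂P = (2 : ℝ) • ∫ ω, X t ω ∂P := by
    have := ((h 4 (by norm_num)).identDistrib t).integral_eq
    rwa [show √(4 : ℝ) = 2 by rw [show (4 : ℝ) = 2 ^ 2 by norm_num, Real.sqrt_sq zero_le_two],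
      integral_smul] at this
  rw [show 4 * t = 2 * (2 * t) by ring, hdouble, hdouble, two_smul, add_eq_left] at h4
  simpa using h4

theorem IsOFBM.isOBM [IsProbabilityMeasure P] (hX : IsOFBM X P)
    (hexp : IsExponent X P ((1 / 2 : ℝ) • (1 : Matrix (Fin n) (Fin n) ℝ)))
    (hrev : IsTimeReversible X P) : IsOBM X P := by
  rw [isExponent_half_iff] at hexp
  have hG := hX.gaussian
  have hst := hX.stationaryIncrements
  have hzero := ae_zero_of_exponent_half hG hexp
  refine ⟨hG, integral_eq_zero_of_exponent_half hG hst hexp, hX.oss, hst,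
    hasIndepIncrements_of_crossCov hG fun L M a b c d hab hbc hcd ↦ ?_, hzero⟩
  refine kernel_increments_eq_zero (R := crossCov X P L M)
    (crossCov_eq_zero_of_ae_eq_zero_left hzero L M)
    (crossCov_eq_zero_of_ae_eq_zero_right hzero L M)
    (fun s t ↦ (hrev.crossCov_eq L M s t).symm) (fun r s t hr ↦ ?_)
    (crossCov_translate hG hst hzero L M) hab hbc hcd
  refine ((hexp r hr).crossCov_eq L M s t).trans ?_
  rw [crossCov_smul, Real.sq_sqrt hr.le]

namespace IsOBM

variable [IsProbabilityMeasure P]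

theorem crossCov_diag_mul (hX : IsOBM X P) (L M : StrongDual ℝ (State n)) {c : ℝ} (hc : 0 < c)
    (t : ℝ) : crossCov X P L M (c * t) (c * t) = c * crossCov X P L M t t := by
  have hl := crossCov_eq_zero_of_ae_eq_zero_left hX.zero
  have hr := crossCov_eq_zero_of_ae_eq_zero_right hX.zero
  have htrans := crossCov_translate hX.gaussian hX.stationaryIncrements hX.zero
  have hindep := HasIndepIncrements.crossCov_eq_zero hX.gaussian hX.indepIncrements
  have hself : ∀ (L : StrongDual ℝ (State n)) (t : ℝ), 0 ≤ t →
      crossCov X P L L (c * t) (c * t) = c * crossCov X P L L t t := fun L t ht ↦ by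
    refine eq_mul_of_nonneg_of_add (g := fun t ↦ crossCov X P L L t t)
      (fun t _ ↦ integral_nonneg fun ω ↦ mul_self_nonneg _) (fun s t hs ht ↦ ?_) hc.le ht
    refine kernel_diag_add (hl L L) (hr L L) (hindep L L) (fun a b c d h₁ h₂ h₃ ↦ ?_)
      (htrans L L) hs ht
    linarith [hindep L L a b c d h₁ h₂ h₃, crossCov_comm (P := P) X L L d b,
      crossCov_comm (P := P) X L L c b, crossCov_comm (P := P) X L L d a,
      crossCov_comm (P := P) X L L c a]
  -- Polarization: apply `hself` to `L + M`, `L` and `M`.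
  have hnonneg : ∀ t, 0 ≤ t →
      crossCov X P L M (c * t) (c * t) = c * crossCov X P L M t t := fun t ht ↦ by
    have h := hself (L + M) t ht
    rw [crossCov_add_self hX.gaussian, crossCov_add_self hX.gaussian] at h
    linarith [hself L t ht, hself M t ht]
  rcases le_total 0 t with ht | ht
  · exact hnonneg t ht
  · have hneg := kernel_diag_neg (hl L M) (hr L M) (htrans L M)
    rw [← hneg, ← hneg t, ← mul_neg]
    exact hnonneg _ (neg_nonneg.2 ht)

theorem isTimeReversible (hX : IsOBM X P) : IsTimeReversible X P := by
  refine identDistrib_restrict_of_crossCov_eq hX.gaussian (hX.gaussian.comp_right Neg.neg)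
    (fun t ↦ (hX.zeroMean t).trans (hX.zeroMean (-t)).symm) fun L M s t ↦ ?_
  have hindep := HasIndepIncrements.crossCov_eq_zero hX.gaussian hX.indepIncrements
  refine (kernel_neg (R := crossCov X P L M)
    (crossCov_eq_zero_of_ae_eq_zero_left hX.zero L M)
    (crossCov_eq_zero_of_ae_eq_zero_right hX.zero L M) (hindep L M) (fun a b c d h₁ h₂ h₃ ↦ ?_)
    (crossCov_translate hX.gaussian hX.stationaryIncrements hX.zero L M) s t).symm
  simpa only [crossCov_comm (P := P) X M L] using hindep M L a b c d h₁ h₂ h₃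

theorem isExponent_half (hX : IsOBM X P) :
    IsExponent X P ((1 / 2 : ℝ) • (1 : Matrix (Fin n) (Fin n) ℝ)) := by
  rw [isExponent_half_iff]
  intro r hr
  refine identDistrib_restrict_of_crossCov_eq (hX.gaussian.comp_right (r * ·))
    (hX.gaussian.smul fun _ ↦ √r) (fun t ↦ ?_) fun L M s t ↦ ?_
  · rw [integral_smul, hX.zeroMean t, smul_zero]
    exact hX.zeroMean (r * t)
  have hindep := HasIndepIncrements.crossCov_eq_zero hX.gaussian hX.indepIncrements
  rw [crossCov_smul, Real.sq_sqrt hr.le]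
  refine kernel_mul (R := crossCov X P L M)
    (crossCov_eq_zero_of_ae_eq_zero_left hX.zero L M)
    (crossCov_eq_zero_of_ae_eq_zero_right hX.zero L M) (hindep L M) (fun a b c d h₁ h₂ h₃ ↦ ?_)
    hr (hX.crossCov_diag_mul L M hr) s t
  simpa only [crossCov_comm (P := P) X M L] using hindep M L a b c d h₁ h₂ h₃

end IsOBM

end FiniteDimLaws

end OperatorFBM

theorem corollary7p1 (n : ℕ) {Ω : Type*} [MeasurableSpace Ω]
    (P : Measure Ω) [IsProbabilityMeasure P] (X : ℝ → Ω → EuclideanSpace ℝ (Fin n)) :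
    (OperatorFBM.IsOFBM X P →
      OperatorFBM.IsExponent X P ((1 / 2 : ℝ) • (1 : Matrix (Fin n) (Fin n) ℝ)) →
      OperatorFBM.IsTimeReversible X P →
      OperatorFBM.IsOBM X P) ∧
    (OperatorFBM.IsOBM X P →
      OperatorFBM.IsTimeReversible X P ∧
      OperatorFBM.IsExponent X P ((1 / 2 : ℝ) • (1 : Matrix (Fin n) (Fin n) ℝ))) :=
  ⟨fun hX hexp hrev ↦ hX.isOBM hexp hrev, fun hX ↦ ⟨hX.isTimeReversible, hX.isExponent_half⟩⟩
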